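/- **Setting.** Let $N$ agents choose actions $u_i\in\mathcal U_i=\{\xi\in\mathbb R^{n_i}\mid B_i\xi\le b_i\}$, let $u=(u_1,\dots,u_N)\in\mathcal U=\mathcal U_1\times\dots\times\mathcal U_N$, let $\mathcal W\subseteq\mathbb R^{n_w}$ be a set of parameters, and let $h:\mathcal U\times\mathcal W\to\mathbb R^{n_y}$. For $w\in\mathcal W$, agent $i$ minimizes $\mathbb J_i(u_i,u_{-i},w):=J_i(u_i,h(u,w))$ over $u_i\in\mathcal U_i$ subject to the coupling constraints $Au\le b$, where $A$ has $m$ rows. Let $F(u,s)$, with values in $\mathbb R^{n_1}\times\dots\times\mathbb R^{n_N}$, represent the pseudo-gradient of the game, that is, for all $u\in\mathcal U$, $w\in\mathcal W$ and all $i$, $F_i(u,h(u,w))=\nabla_{u_i}\mathbb J_i(u_i,u_{-i},w)$, the gradient being taken relative to $\mathcal U_i$; put $\mathbb F(u,w)=F(u,h(u,w))$. With $z=(u,\lambda)\in\mathbb R^{n_1+\dots+n_N}\times\mathbb R^m$, the condensed KKT generalized equation of the game is $$0\in\Psi_w(z):=\begin{bmatrix}\mathbb F(u,w)+A^\top\lambda+\mathcal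 N_{\mathcal U}(u)\\ b-Au+\mathcal N_{\mathbb R^m_{\ge0}}(\lambda)\end{bmatrix},$$ where $\mathcal N_\Omega$ denotes the normal cone operator (empty outside $\Omega$), and $S(w)=\{z\mid 0\in\Psi_w(z)\}$. A set-valued mapping $\Psi$ is *strongly regular* at $(x,y)$ if $y\in\Psi(x)$ and there are neighborhoods $U$ of $x$ and $V$ of $y$ such that $v\mapsto\Psi^{-1}(v)\cap U$ is a single-valued Lipschitz continuous function on $V$. **Lemma.** Suppose that there are constants $\tilde\mu>0$ and $\tilde\ell,\ell\ge0$ such that * (C1) $\mathbb F$ is continuously differentiable on $\mathcal U\times\mathcal W$, and for every $w\in\mathcal W$ the map $\mathbb F(\cdot,w)$ is $\tilde\mu$-strongly monotone and $\tilde\ell$-Lipschitz continuous on $\mathcal U$; * (C2) for every $u\in\mathcal U$ the map $F(u,\cdot)$ is $\ell$-Lipschitz continuous; * (C3) for every $w\in\mathcal W$ and every $(\bar u,\bar\lambda)\in S(w)$, the rows of $\tilde A=\begin{bmatrix}A\\ \operatorname{blkdiag}(B_1,\dots,B_N)\end{bmatrix}$ with index in $\mathcal E(\bar u)=\{k\mid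 \tilde A_k\bar u=\tilde b_k\}$ are linearly independent, where $\tilde b=(b,b_1,\dots,b_N)$. Then, for every $w\in\mathcal W$ and every $\bar z\in S(w)$, the mapping $\Psi_w$ is strongly regular at $(\bar z,0)$. -/

import Mathlib

open scoped Matrix NNReal Topology

noncomputable section

/-- Strong regularity of a set-valued mapping `Ψ` at `(x, y)`: `y ∈ Ψ x`, and there are
neighborhoods `U` of `x` and `V` of `y` such that the truncated inverse `v ↦ Ψ⁻¹(v) ∩ U` is a
single-valued Lipschitz continuous function `g` on `V`. -/
def StronglyRegularAt {X Y : Type*} [PseudoEMetricSpace X] [PseudoEMetricSpace Y]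
    (Ψ : X → Set Y) (x : X) (y : Y) : Prop :=
  y ∈ Ψ x ∧ ∃ U ∈ 𝓝 x, ∃ V ∈ 𝓝 y, ∃ (K : ℝ≥0) (g : Y → X),
    LipschitzOnWith K g V ∧ ∀ v ∈ V, {x' | v ∈ Ψ x'} ∩ U = {g v}

/-- The normal cone of a set `Ω` at `x`; it is empty when `x ∉ Ω`. -/
def normalConeAt {E : Type*} [NormedAddCommGroup E] [InnerProductSpace ℝ E]
    (Ω : Set E) (x : E) : Set E :=
  {v | x ∈ Ω ∧ ∀ y ∈ Ω, inner ℝ v (y - x) ≤ 0}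

/-- `f` is `μ`-strongly monotone on `s`. -/
def StronglyMonotoneOn {E : Type*} [NormedAddCommGroup E] [InnerProductSpace ℝ E]
    (μ : ℝ) (f : E → E) (s : Set E) : Prop :=
  ∀ x ∈ s, ∀ y ∈ s, μ * ‖x - y‖ ^ 2 ≤ inner ℝ (f x - f y) (x - y)

/-- The data of a parametrized generalized Nash game with `N` agents. Agent `i` chooses
`u_i ∈ ℝ^{n i}` subject to `p i` local inequalities, there are `m` coupling inequalities, the
steady-state output is in `ℝ^{ny}` and the parameter is in `ℝ^{nw}`. The index type of the
coordinates of a joint action `u = (u_1, …, u_N)` is `Σ i, Fin (n i)`. -/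
structure ParamGame (N : ℕ) (n p : Fin N → ℕ) (m ny nw : ℕ) where
  /-- cost functions `J_i(u_i, s)` -/
  J : (i : Fin N) → EuclideanSpace ℝ (Fin (n i)) → EuclideanSpace ℝ (Fin ny) → ℝ
  /-- steady-state input-output map `h(u, w)` (only its values on `𝒰 × 𝒲` matter) -/
  h : EuclideanSpace ℝ (Σ i, Fin (n i)) → EuclideanSpace ℝ (Fin nw) → EuclideanSpace ℝ (Fin ny)
  /-- set of admissible parameters -/
  W : Set (EuclideanSpace ℝ (Fin nw))
  /-- local constraint matrices `B_i` -/
  B : (i : Fin N) → Matrix (Fin (p i)) (Fin (n i)) ℝ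
  /-- local right-hand sides `b_i` -/
  bloc : (i : Fin N) → Fin (p i) → ℝ
  /-- coupling constraint matrix -/
  A : Matrix (Fin m) (Σ i, Fin (n i)) ℝ
  /-- coupling right-hand side -/
  b : Fin m → ℝ

namespace ParamGame

/-- The block `u_i` of a joint vector `u`. -/
def block {N : ℕ} {n : Fin N → ℕ} (u : EuclideanSpace ℝ (Σ i, Fin (n i))) (i : Fin N) :
    EuclideanSpace ℝ (Fin (n i)) :=
  WithLp.toLp 2 (fun j => u ⟨i, j⟩)

/-- The joint vector `(v, u_{-i})`: the block `i` of `u` is replaced by `v`. -/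
def replaceBlock {N : ℕ} {n : Fin N → ℕ} (u : EuclideanSpace ℝ (Σ i, Fin (n i))) (i : Fin N)
    (v : EuclideanSpace ℝ (Fin (n i))) : EuclideanSpace ℝ (Σ i, Fin (n i)) :=
  WithLp.toLp 2 (fun k => Function.update (fun i' => (block u i').ofLp) i v.ofLp k.1 k.2)

variable {N : ℕ} {n p : Fin N → ℕ} {m ny nw : ℕ} (Γ : ParamGame N n p m ny nw)

/-- The local constraint set `𝒰_i = {ξ | B_i ξ ≤ b_i}`. -/
def localSet (i : Fin N) : Set (EuclideanSpace ℝ (Fin (n i))) :=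
  {ξ | ∀ r, (Γ.B i *ᵥ ξ.ofLp) r ≤ Γ.bloc i r}

/-- `𝒰 = 𝒰_1 × ⋯ × 𝒰_N`. -/
def actionSet : Set (EuclideanSpace ℝ (Σ i, Fin (n i))) :=
  {u | ∀ i, block u i ∈ Γ.localSet i}

/-- The cost `𝕁_i(u_i, u_{-i}, w) = J_i(u_i, h(u, w))` of agent `i`. -/
def jointCost (i : Fin N) (u : EuclideanSpace ℝ (Σ i, Fin (n i)))
    (w : EuclideanSpace ℝ (Fin nw)) : ℝ :=
  Γ.J i (block u i) (Γ.h u w)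

/-- `F(u, s)` represents the pseudo-gradient of the game: for `w ∈ 𝒲` and `u ∈ 𝒰`, the block
`F_i(u, h(u, w))` is the gradient of `v ↦ 𝕁_i(v, u_{-i}, w)` at `v = u_i`. The gradient is taken
relative to `𝒰_i`, since `h` is only meant to be given on `𝒰 × 𝒲`. -/
def IsPseudoGradient
    (F : EuclideanSpace ℝ (Σ i, Fin (n i)) → EuclideanSpace ℝ (Fin ny) →
      EuclideanSpace ℝ (Σ i, Fin (n i))) : Prop :=
  ∀ w ∈ Γ.W, ∀ u ∈ Γ.actionSet, ∀ i,
    HasGradientWithinAt (fun v => Γ.jointCost i (replaceBlock u i v) w)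
      (block (F u (Γ.h u w)) i) (Γ.localSet i) (block u i)

/-- The space of `z = (u, λ)`, with its Euclidean norm. -/
abbrev ZSpace {N : ℕ} (n : Fin N → ℕ) (m : ℕ) : Type :=
  WithLp 2 (EuclideanSpace ℝ (Σ i, Fin (n i)) × EuclideanSpace ℝ (Fin m))

/-- The single-valued part `G(z, s) = (F(u, s), b)`. -/
def mapG
    (F : EuclideanSpace ℝ (Σ i, Fin (n i)) → EuclideanSpace ℝ (Fin ny) →
      EuclideanSpace ℝ (Σ i, Fin (n i)))
    (z : ZSpace n m) (s : EuclideanSpace ℝ (Fin ny)) : ZSpace n m :=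
  WithLp.toLp 2 (F z.fst s, WithLp.toLp 2 Γ.b)

/-- The nonnegative orthant. -/
def orthant (m : ℕ) : Set (EuclideanSpace ℝ (Fin m)) := {l | ∀ k, 0 ≤ l k}

/-- The set-valued part `𝒜(z) = (Aᵀ λ + N_𝒰(u), - A u + N_{ℝ^m_{≥0}}(λ))`. -/
def mapA (z : ZSpace n m) : Set (ZSpace n m) :=
  {y | ∃ ν ∈ normalConeAt Γ.actionSet z.fst, ∃ η ∈ normalConeAt (orthant m) z.snd,
    y = WithLp.toLp 2
      (WithLp.toLp 2 (Γ.Aᵀ *ᵥ z.snd.ofLp) + ν, -WithLp.toLp 2 (Γ.A *ᵥ z.fst.ofLp) + η)}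

/-- The condensed mapping `z ↦ 𝔾(z, w) + 𝒜(z)`, with `𝔾(z, w) = G(z, h(q(z), w))` and
`q(z) = u`. -/
def condensedMap
    (F : EuclideanSpace ℝ (Σ i, Fin (n i)) → EuclideanSpace ℝ (Fin ny) →
      EuclideanSpace ℝ (Σ i, Fin (n i)))
    (w : EuclideanSpace ℝ (Fin nw)) (z : ZSpace n m) : Set (ZSpace n m) :=
  {y | ∃ a ∈ Γ.mapA z, y = Γ.mapG F z (Γ.h z.fst w) + a}

/-- The solution mapping `S(w) = {z | 0 ∈ 𝔾(z, w) + 𝒜(z)}`. -/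
def solutionSet
    (F : EuclideanSpace ℝ (Σ i, Fin (n i)) → EuclideanSpace ℝ (Fin ny) →
      EuclideanSpace ℝ (Σ i, Fin (n i)))
    (w : EuclideanSpace ℝ (Fin nw)) : Set (ZSpace n m) :=
  {z | 0 ∈ Γ.condensedMap F w z}

/-- All constraints stacked: the rows of `A`, then those of `blkdiag(B_1, …, B_N)`. -/
def stackedMatrix : Matrix (Fin m ⊕ (Σ i, Fin (p i))) (Σ i, Fin (n i)) ℝ :=
  Matrix.fromRows Γ.A (Matrix.blockDiagonal' Γ.B)

/-- The stacked right-hand side `(b, b_1, …, b_N)`. -/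
def stackedRhs : Fin m ⊕ (Σ i, Fin (p i)) → ℝ :=
  Sum.elim Γ.b (fun k => Γ.bloc k.1 k.2)

/-- The set of active constraints at `u`. -/
def activeSet (u : EuclideanSpace ℝ (Σ i, Fin (n i))) : Set (Fin m ⊕ (Σ i, Fin (p i))) :=
  {k | (Γ.stackedMatrix *ᵥ u.ofLp) k = Γ.stackedRhs k}

/-- LICQ at `u`: the rows of the active constraints are linearly independent. -/
def LICQ (u : EuclideanSpace ℝ (Σ i, Fin (n i))) : Prop :=
  LinearIndependent ℝ (fun k : Γ.activeSet u => Γ.stackedMatrix.row k)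

end ParamGame

end

/-! A perturbation `v = (v₁, e)` of the generalized equation turns it into the KKT system of the
variational inequality for `𝔽(·, w) - v₁` over the polyhedron `{u ∈ 𝒰 | A u ≤ b - e}`: data and
right-hand side move, the constraint rows do not. So strong regularity is solvability, uniqueness
and Lipschitz dependence for small `v`.

Linear independence of the rows active at the reference point enters only through a dual family `d`,
with `⟪a j, d k⟫ = δ_jk` on the active set `E`. It gives feasible points of the perturbed polyhedra
near the reference point (`DualOn.exists_feasible`), multipliers without Farkas' lemma
(`DualOn.exists_multipliers`) and a bound on multipliers by the vector they represent
(`DualOn.sum_abs_le`).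

A strongly monotone Lipschitz inequality is solvable by contraction. Strong monotonicity keeps
solutions of perturbed problems near the reference point, so their active rows stay in `E`
(`eventually_solvable`). The one family `d` then serves all small perturbations, and comparing two
KKT systems bounds both the solutions and the multipliers (`IsKKT.lipschitz_estimate`); equal data
give uniqueness. -/

namespace PolyhedralVI

open Filter

/-! ### Existence by projection and contraction -/

variable {H : Type*} [NormedAddCommGroup H] [InnerProductSpace ℝ H]

/-- A strongly monotone Lipschitz variational inequality over a nonempty, convex, complete set has
a solution. -/
theorem exists_solution {C : Set H} (hne : C.Nonempty) (hcomp : IsComplete C)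
    (hconv : Convex ℝ C) {f : H → H} {μ : ℝ} (hμ : 0 < μ) {L : ℝ≥0}
    (hmono : StronglyMonotoneOn μ f C) (hlip : LipschitzOnWith L f C) :
    ∃ x ∈ C, ∀ y ∈ C, inner ℝ (-f x) (y - x) ≤ 0 := by
  have hproj : ∀ u : H, ∃ v ∈ C, ∀ w ∈ C, inner ℝ (u - v) (w - v) ≤ 0 := fun u => by
    obtain ⟨v, hv, h⟩ := exists_norm_eq_iInf_of_complete_convex hne hcomp hconv u
    exact ⟨v, hv, (norm_eq_iInf_iff_real_inner_le_zero hconv hv).1 h⟩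
  choose P hPC hP using hproj
  have hPnonexp : ∀ u v, ‖P u - P v‖ ≤ ‖u - v‖ := fun u v => by
    have h1 := hP u (P v) (hPC v)
    have h2 := hP v (P u) (hPC u)
    have h3 : ‖P u - P v‖ ^ 2 ≤ inner ℝ (u - v) (P u - P v) := by
      rw [← real_inner_self_eq_norm_sq]
      simp only [inner_sub_left, inner_sub_right] at *
      linarith
    have h4 := real_inner_le_norm (u - v) (P u - P v)
    by_contra! h
    nlinarith [norm_nonneg (u - v), norm_nonneg (P u - P v)]
  -- `M` is a Lipschitz bound that is positive even if `L = 0` and at least `μ`. With `γ = μ / M ^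
  -- 2` the squared contraction factor `1 - 2γμ + γ²M²` of the projected step `T` equals `1 - γμ`,
  -- which lies in `[0, 1)`.
  set M : ℝ := L + μ with hM
  have hM0 : 0 < M := by positivity
  have hμM : μ ≤ M := by simp [hM]
  set γ : ℝ := μ / M ^ 2 with hγ
  have hγ0 : 0 < γ := by positivity
  have hγM : γ * M ^ 2 = μ := by rw [hγ]; field_simp
  set q : ℝ := 1 - γ * μ with hq
  have hγμ : γ * μ ≤ 1 := by
    rw [hγ, div_mul_eq_mul_div, div_le_one (by positivity)]
    nlinarith
  have hq0 : 0 ≤ q := by linarith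
  have hq1 : q < 1 := by have := mul_pos hγ0 hμ; linarith
  let T : H → H := fun x => P (x - γ • f x)
  have hT : ∀ x ∈ C, ∀ y ∈ C, dist (T x) (T y) ≤ √q * dist x y := fun x hx y hy => by
    rw [dist_eq_norm, dist_eq_norm]
    refine (hPnonexp _ _).trans ?_
    have hm := hmono x hx y hy
    have hl : ‖f x - f y‖ ≤ M * ‖x - y‖ := by
      have := hlip.dist_le_mul x hx y hy
      rw [dist_eq_norm, dist_eq_norm] at this
      refine this.trans ?_
      gcongr
      simp [hM, hμ.le]
    have e : x - γ • f x - (y - γ • f y) = (x - y) - γ • (f x - f y) := by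
      rw [smul_sub]; abel
    refine le_of_sq_le_sq ?_ (by positivity)
    rw [mul_pow, Real.sq_sqrt hq0, e, norm_sub_sq_real, inner_smul_right, norm_smul,
      Real.norm_of_nonneg hγ0.le, real_inner_comm]
    have hl2 : ‖f x - f y‖ ^ 2 ≤ M ^ 2 * ‖x - y‖ ^ 2 := by
      rw [← mul_pow]; gcongr
    calc ‖x - y‖ ^ 2 - 2 * (γ * inner ℝ (f x - f y) (x - y)) + (γ * ‖f x - f y‖) ^ 2
        ≤ ‖x - y‖ ^ 2 - 2 * (γ * (μ * ‖x - y‖ ^ 2)) + γ ^ 2 * (M ^ 2 * ‖x - y‖ ^ 2) := by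
          rw [mul_pow]; gcongr
      _ = q * ‖x - y‖ ^ 2 := by
          rw [hq]; linear_combination (γ * ‖x - y‖ ^ 2) * hγM
  have hmaps : Set.MapsTo T C C := fun x _ => hPC _
  have hcontr : ContractingWith (NNReal.sqrt q.toNNReal) (hmaps.restrict T C C) := by
    have hcoe : ((NNReal.sqrt q.toNNReal : ℝ≥0) : ℝ) = √q := by
      rw [Real.coe_sqrt, Real.coe_toNNReal q hq0]
    refine ⟨?_, LipschitzWith.of_dist_le_mul fun x y => ?_⟩
    · rw [← NNReal.coe_lt_coe, hcoe]
      simpa [Real.sqrt_lt' one_pos] using hq1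
    · rw [hcoe]
      exact hT x x.2 y y.2
  obtain ⟨x₀, hx₀⟩ := hne
  obtain ⟨x, hx, hfix, -⟩ := hcontr.exists_fixedPoint' hcomp hmaps hx₀ (edist_ne_top _ _)
  refine ⟨x, hx, fun y hy => ?_⟩
  have h := hP (x - γ • f x) y hy
  have hfix' : P (x - γ • f x) = x := hfix
  rw [hfix', sub_sub_cancel_left, ← smul_neg, inner_smul_left] at h
  simpa using nonpos_of_mul_nonpos_right h (by simpa using hγ0)

/-! ### Polyhedra, dual families and multipliers -/

variable {κ : Type*}

/-- The polyhedron of the points `x` with `⟪a k, x⟫ ≤ r k` for all `k`. -/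
def polyhedron (a : κ → H) (r : κ → ℝ) : Set H := {x | ∀ k, inner ℝ (a k) x ≤ r k}

theorem isClosed_polyhedron (a : κ → H) (r : κ → ℝ) : IsClosed (polyhedron a r) := by
  simp only [polyhedron, Set.ofPred_forall]
  exact isClosed_iInter fun k => isClosed_le (by fun_prop) continuous_const

theorem convex_polyhedron (a : κ → H) (r : κ → ℝ) : Convex ℝ (polyhedron a r) := by
  intro x hx y hy s t hs ht hst k
  rw [inner_add_right, inner_smul_right, inner_smul_right]
  calc s * inner ℝ (a k) x + t * inner ℝ (a k) y ≤ s * r k + t * r k := by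
        gcongr
        exacts [hx k, hy k]
    _ = r k := by rw [← add_mul, hst, one_mul]

/-- `d` is a dual family of `a` on the index set `E`. -/
structure DualOn (a d : κ → H) (E : Set κ) : Prop where
  one : ∀ j ∈ E, inner ℝ (a j) (d j) = 1
  zero : ∀ j ∈ E, ∀ k ∈ E, j ≠ k → inner ℝ (a j) (d k) = 0

theorem DualOn.mono {a d : κ → H} {E E' : Set κ} (h : DualOn a d E) (hE : E' ⊆ E) :
    DualOn a d E' :=
  ⟨fun j hj => h.one j (hE hj), fun j hj k hk => h.zero j (hE hj) k (hE hk)⟩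

/-- The coordinate functionals on the span of the independent rows extend to `H`; their Riesz
representatives form the dual family. -/
theorem exists_dualOn [FiniteDimensional ℝ H] {a : κ → H} {E : Set κ}
    (h : LinearIndependent ℝ fun k : E => a k) : ∃ d : κ → H, DualOn a d E := by
  classical
  have hφ : ∀ k : E, ∃ y : H, ∀ j : E, inner ℝ (a j) y = if j = k then 1 else 0 := fun k => by
    obtain ⟨φ, hφ⟩ := LinearMap.exists_extend ((Finsupp.lapply k).comp h.repr : _ →ₗ[ℝ] ℝ)
    refine ⟨(InnerProductSpace.toDual ℝ H).symm φ.toContinuousLinearMap, fun j => ?_⟩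
    rw [real_inner_comm, InnerProductSpace.toDual_symm_apply, LinearMap.coe_toContinuousLinearMap']
    let x : Submodule.span ℝ (Set.range fun k : E => a k) := ⟨a j, Submodule.subset_span ⟨j, rfl⟩⟩
    have h1 := LinearMap.congr_fun hφ x
    have h2 := h.repr_eq_single j x rfl
    simp only [LinearMap.comp_apply, Submodule.subtype_apply] at h1
    rw [show a j = (x : H) from rfl, h1]
    rw [h2, Finsupp.lapply_apply, Finsupp.single_apply]
  choose y hy using hφ
  refine ⟨fun k => if hk : k ∈ E then y ⟨k, hk⟩ else 0, ?_, ?_⟩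
  · intro j hj
    have := hy ⟨j, hj⟩ ⟨j, hj⟩
    simpa [hj] using this
  · intro j hj k hk hjk
    have := hy ⟨k, hk⟩ ⟨j, hj⟩
    simpa [hk, hjk] using this

variable [Fintype κ]

theorem DualOn.inner_sum_left {a d : κ → H} {E : Set κ} (h : DualOn a d E) {c : κ → ℝ}
    (hc : ∀ k ∉ E, c k = 0) {j : κ} (hj : j ∈ E) :
    inner ℝ (∑ k, c k • a k) (d j) = c j := by
  rw [sum_inner, Finset.sum_eq_single j]
  · simp [inner_smul_left, h.one j hj]
  · intro k _ hkj
    by_cases hk : k ∈ E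
    · simp [inner_smul_left, h.zero k hk j hj hkj]
    · simp [hc k hk]
  · simp

theorem DualOn.inner_sum_right {a d : κ → H} {E : Set κ} (h : DualOn a d E) {c : κ → ℝ}
    (hc : ∀ k ∉ E, c k = 0) {j : κ} (hj : j ∈ E) :
    inner ℝ (a j) (∑ k, c k • d k) = c j := by
  rw [inner_sum, Finset.sum_eq_single j]
  · simp [inner_smul_right, h.one j hj]
  · intro k _ hkj
    by_cases hk : k ∈ E
    · simp [inner_smul_right, h.zero j hj k hk hkj.symm]
    · simp [hc k hk]
  · simp

/-- Normal vectors to a polyhedron, at a point where the active rows have a dual family, are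
nonnegative combinations of the active rows. -/
theorem DualOn.exists_multipliers {a d : κ → H} {E : Set κ} (h : DualOn a d E) {r : κ → ℝ} {x ν : H}
    (hx : x ∈ polyhedron a r) (hE : ∀ k, inner ℝ (a k) x = r k → k ∈ E)
    (hν : ∀ y ∈ polyhedron a r, inner ℝ ν (y - x) ≤ 0) :
    ∃ c : κ → ℝ, (∀ k, 0 ≤ c k) ∧ (∀ k, c k * (r k - inner ℝ (a k) x) = 0) ∧
      ν = ∑ k, c k • a k := by
  classical
  set S : Set κ := {k | inner ℝ (a k) x = r k} with hS
  have hdS : DualOn a d S := h.mono hE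
  -- A direction that increases no active row stays feasible for a short time, since the inactive
  -- rows have slack.
  have hdir : ∀ e : H, (∀ k ∈ S, inner ℝ (a k) e ≤ 0) → inner ℝ ν e ≤ 0 := fun e he => by
    have hev : ∀ᶠ t : ℝ in 𝓝[>] 0, ∀ k, inner ℝ (a k) (x + t • e) ≤ r k := by
      refine eventually_all.2 fun k => ?_
      by_cases hk : k ∈ S
      · filter_upwards [self_mem_nhdsWithin] with t ht
        rw [inner_add_right, inner_smul_right]
        have hk' : inner ℝ (a k) x = r k := hk
        nlinarith [he k hk, Set.mem_Ioi.1 ht]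
      · have hlt : inner ℝ (a k) (x + (0 : ℝ) • e) < r k := by
          simpa using lt_of_le_of_ne (hx k) hk
        have hcont : Continuous fun t : ℝ => inner ℝ (a k) (x + t • e) := by fun_prop
        exact nhdsWithin_le_nhds
          ((hcont.tendsto 0).eventually_lt_const hlt |>.mono fun _ => le_of_lt)
    obtain ⟨t, ht, ht0⟩ := (hev.and self_mem_nhdsWithin).exists
    have h1 := hν (x + t • e) ht
    rw [add_sub_cancel_left, inner_smul_right] at h1
    exact nonpos_of_mul_nonpos_right h1 ht0
  -- Pairing `ν = ∑ c k • a k` with `d k` forces this value; its sign comes from the admissible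
  -- direction `-d k`.
  let c : κ → ℝ := fun k => if k ∈ S then inner ℝ ν (d k) else 0
  have hcS : ∀ k ∉ S, c k = 0 := fun k hk => if_neg hk
  refine ⟨c, fun k => ?_, fun k => ?_, ?_⟩
  · by_cases hk : k ∈ S
    · have := hdir (-d k) fun j hj => by
        rw [inner_neg_right, neg_nonpos]
        rcases eq_or_ne j k with rfl | hjk
        · rw [hdS.one j hj]; exact zero_le_one
        · rw [hdS.zero j hj k hk hjk]
      rw [inner_neg_right, neg_nonpos] at this
      simpa [c, hk] using this
    · exact (hcS k hk).ge
  · by_cases hk : k ∈ S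
    · rw [show inner ℝ (a k) x = r k from hk, sub_self, mul_zero]
    · rw [hcS k hk, zero_mul]
  · refine ext_inner_right ℝ fun y => ?_
    -- `y - ∑ b j • d j` is orthogonal to all active rows, so it and its negative are admissible and
    -- `ν` vanishes on it.
    let b : κ → ℝ := fun k => if k ∈ S then inner ℝ (a k) y else 0
    have hb : ∀ k ∈ S, inner ℝ (a k) (∑ j, b j • d j) = inner ℝ (a k) y := fun k hk => by
      rw [hdS.inner_sum_right (fun k hk => if_neg hk) hk]
      exact if_pos hk
    have h1 := hdir (y - ∑ j, b j • d j) fun k hk => by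
      rw [inner_sub_right, hb k hk, sub_self]
    have h2 := hdir (-(y - ∑ j, b j • d j)) fun k hk => by
      rw [inner_neg_right, inner_sub_right, hb k hk, sub_self, neg_zero]
    rw [inner_neg_right] at h2
    rw [inner_sub_right] at h1 h2
    rw [show inner ℝ ν y = inner ℝ ν (∑ j, b j • d j) by linarith, inner_sum, sum_inner]
    refine Finset.sum_congr rfl fun k _ => ?_
    by_cases hk : k ∈ S
    · simp [b, c, hk, inner_smul_left, inner_smul_right, mul_comm]
    · simp [b, c, hk]

/-! ### Variational inequalities and KKT systems -/

/-- `x` solves the variational inequality of `f - v` over the polyhedron with right-hand side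
`r`. -/
def IsSolution (f : H → H) (a : κ → H) (v : H) (r : κ → ℝ) (x : H) : Prop :=
  x ∈ polyhedron a r ∧ ∀ y ∈ polyhedron a r, inner ℝ (v - f x) (y - x) ≤ 0

/-- The Karush–Kuhn–Tucker system of the variational inequality of `f - v` over the polyhedron with
right-hand side `r`. -/
structure IsKKT (f : H → H) (a : κ → H) (v : H) (r : κ → ℝ) (x : H) (c : κ → ℝ) : Prop where
  mem : x ∈ polyhedron a r
  nonneg : ∀ k, 0 ≤ c k
  compl : ∀ k, c k * (r k - inner ℝ (a k) x) = 0
  stat : v - f x = ∑ k, c k • a k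

variable {f : H → H} {a : κ → H} {v : H} {r : κ → ℝ} {x : H} {c : κ → ℝ}

/-- By complementarity `c k * ⟪a k, x⟫ = c k * r k`. Allowing `y` to lie in a polyhedron with
another right-hand side makes it possible to compare two perturbed problems. -/
theorem inner_sum_smul_sub_le {a : κ → H} {c : κ → ℝ} {r r' : κ → ℝ} {x y : H}
    (hc : ∀ k, 0 ≤ c k) (hcompl : ∀ k, c k * (r k - inner ℝ (a k) x) = 0)
    (hy : y ∈ polyhedron a r') :
    inner ℝ (∑ k, c k • a k) (y - x) ≤ ∑ k, c k * (r' k - r k) := by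
  rw [sum_inner]
  refine Finset.sum_le_sum fun k _ => ?_
  rw [real_inner_smul_left, inner_sub_right]
  have := mul_le_mul_of_nonneg_left (hy k) (hc k)
  linarith [hcompl k]

theorem IsKKT.eq_zero {E : Set κ} (h : IsKKT f a v r x c)
    (hE : ∀ k, inner ℝ (a k) x = r k → k ∈ E) : ∀ k ∉ E, c k = 0 := fun k hk =>
  (mul_eq_zero.1 (h.compl k)).resolve_right fun h0 => hk (hE k (by linarith))

theorem IsSolution.exists_isKKT {d : κ → H} {E : Set κ} (hd : DualOn a d E)
    (h : IsSolution f a v r x) (hE : ∀ k, inner ℝ (a k) x = r k → k ∈ E) :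
    ∃ c, IsKKT f a v r x c := by
  obtain ⟨c, h1, h2, h3⟩ := hd.exists_multipliers h.1 hE h.2
  exact ⟨c, h.1, h1, h2, h3⟩

/-- If `t > ρ`, each term on the right would be less than `μ t² / 2`. -/
theorem le_of_mul_sq_le {μ t q₁ q₀ ρ : ℝ} (hμ : 0 < μ) (hρ : 0 < ρ)
    (h : μ * t ^ 2 ≤ q₁ * t + q₀) (h₁ : q₁ < μ * ρ / 2) (h₀ : q₀ < μ * ρ ^ 2 / 2) : t ≤ ρ := by
  by_contra! ht
  have h2 : q₁ * t ≤ μ * ρ / 2 * t := by gcongr; exact (hρ.trans ht).le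
  nlinarith [mul_pos hμ hρ, mul_pos (mul_pos hμ hρ) (sub_pos.2 ht),
    mul_pos hμ (mul_pos (sub_pos.2 ht) (sub_pos.2 ht))]

/-! ### Stability under perturbation of the data -/

section Perturbation

variable {d : κ → H} {D : Set H} {μ : ℝ} {L : ℝ≥0}

/-- The perturbed polyhedra contain points close to `x`. -/
theorem DualOn.exists_feasible (hd : DualOn a d {k | inner ℝ (a k) x = r k})
    (hx : x ∈ polyhedron a r) :
    ∃ p : (κ → ℝ) → H, Continuous p ∧ p r = x ∧ ∀ᶠ r' in 𝓝 r, p r' ∈ polyhedron a r' := by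
  classical
  set E : Set κ := {k | inner ℝ (a k) x = r k} with hE
  -- Moving along `d k` by `r' k - r k` keeps each active row exactly active; inactive rows remain
  -- slack by continuity.
  let p : (κ → ℝ) → H := fun r' => x + ∑ k, (if k ∈ E then r' k - r k else 0) • d k
  have hp : Continuous p := by
    refine continuous_const.add (continuous_finsetSum _ fun k _ => ?_)
    refine Continuous.smul ?_ continuous_const
    split_ifs <;> fun_prop
  have hpr : p r = x := by simp [p]
  refine ⟨p, hp, hpr, eventually_all.2 fun k => ?_⟩
  by_cases hk : k ∈ E
  · refine Eventually.of_forall fun r' => ?_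
    rw [inner_add_right, hd.inner_sum_right (fun j hj => if_neg hj) hk, if_pos hk,
      show inner ℝ (a k) x = r k from hk]
    linarith
  · have h1 : Continuous fun r' => inner ℝ (a k) (p r') := by fun_prop
    have h2 : Continuous fun r' : κ → ℝ => r' k := by fun_prop
    have h3 : inner ℝ (a k) (p r) < r k := by rw [hpr]; exact lt_of_le_of_ne (hx k) hk
    exact ((h1.tendsto r).eventually_lt (h2.tendsto r) h3).mono fun _ => le_of_lt

/-- Solutions of perturbed variational inequalities are close to `x`. -/
theorem eventually_norm_sub_le (hμ : 0 < μ) (hmono : StronglyMonotoneOn μ f D)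
    (hlip : LipschitzOnWith L f D) (hxD : x ∈ D)
    (hd : DualOn a d {k | inner ℝ (a k) x = r k}) (h : IsKKT f a v r x c) {ρ : ℝ} (hρ : 0 < ρ) :
    ∀ᶠ q : H × (κ → ℝ) in 𝓝 (v, r), polyhedron a q.2 ⊆ D →
      ∀ y, IsSolution f a q.1 q.2 y → ‖y - x‖ ≤ ρ := by
  obtain ⟨p, hp, hpr, hfeas⟩ := hd.exists_feasible h.mem
  -- Coefficients of a quadratic inequality for `‖y - x‖`, both vanishing at the reference data. No
  -- multipliers of `y` are used, since its active rows are not yet controlled.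
  let q₁ : H × (κ → ℝ) → ℝ := fun q => ‖q.1 - v‖ + L * ‖p q.2 - x‖
  let q₀ : H × (κ → ℝ) → ℝ := fun q =>
    (‖q.1 - f x‖) * ‖p q.2 - x‖ + ∑ k, c k * (q.2 k - r k)
  have c₁ : Continuous q₁ := by fun_prop
  have c₀ : Continuous q₀ := by fun_prop
  have z₁ : q₁ (v, r) = 0 := by simp [q₁, hpr]
  have z₀ : q₀ (v, r) = 0 := by simp [q₀, hpr]
  have e₁ := (c₁.tendsto (v, r)).eventually_lt_const
    (show q₁ (v, r) < μ * ρ / 2 by rw [z₁]; positivity)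
  have e₀ := (c₀.tendsto (v, r)).eventually_lt_const
    (show q₀ (v, r) < μ * ρ ^ 2 / 2 by rw [z₀]; positivity)
  have e₂ : ∀ᶠ q : H × (κ → ℝ) in 𝓝 (v, r), p q.2 ∈ polyhedron a q.2 :=
    (continuous_snd.tendsto (v, r)).eventually hfeas
  filter_upwards [e₁, e₀, e₂] with q h₁ h₀ h₂ hsub y hy
  refine le_of_mul_sq_le hμ hρ ?_ h₁ h₀
  have hm := hmono y (hsub hy.1) x hxD
  have hl : ‖f y - f x‖ ≤ L * ‖y - x‖ := by
    simpa [dist_eq_norm] using hlip.dist_le_mul y (hsub hy.1) x hxD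
  have hv := hy.2 _ h₂
  have hk := inner_sum_smul_sub_le h.nonneg h.compl hy.1
  rw [← h.stat] at hk
  have i1 := real_inner_le_norm (q.1 - v) (y - x)
  have i2 := real_inner_le_norm (-(q.1 - f x)) (p q.2 - x)
  have i3 := real_inner_le_norm (f y - f x) (p q.2 - x)
  have i4 : ‖f y - f x‖ * ‖p q.2 - x‖ ≤ L * ‖y - x‖ * ‖p q.2 - x‖ := by gcongr
  rw [norm_neg] at i2
  -- The fourth term is nonpositive because `y` is a solution and `p q.2` is feasible; the last is
  -- bounded through the multipliers of `x`.
  have key : inner ℝ (f y - f x) (y - x) = inner ℝ (q.1 - v) (y - x) +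
      inner ℝ (-(q.1 - f x)) (p q.2 - x) + inner ℝ (f y - f x) (p q.2 - x) +
      inner ℝ (q.1 - f y) (p q.2 - y) + inner ℝ (v - f x) (y - x) := by
    simp only [inner_sub_left, inner_sub_right, inner_neg_left]
    ring
  calc μ * ‖y - x‖ ^ 2 ≤ inner ℝ (f y - f x) (y - x) := hm
    _ ≤ q₁ q * ‖y - x‖ + q₀ q := by
        rw [key]; simp only [q₁, q₀]; linarith

/-- Each coefficient is recovered by pairing the combination with its dual vector. -/
theorem DualOn.sum_abs_le {E : Set κ} (hd : DualOn a d E) {c : κ → ℝ} (hc : ∀ k ∉ E, c k = 0) :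
    ∑ k, |c k| ≤ (∑ k, ‖d k‖) * ‖∑ k, c k • a k‖ := by
  rw [Finset.sum_mul]
  refine Finset.sum_le_sum fun k _ => ?_
  by_cases hk : k ∈ E
  · rw [← hd.inner_sum_left hc hk, mul_comm]
    exact abs_real_inner_le_norm _ _
  · rw [hc k hk, abs_zero]; positivity

/-- Lipschitz dependence of the KKT pair on the data. -/
theorem IsKKT.lipschitz_estimate (hμ : 0 < μ) (hmono : StronglyMonotoneOn μ f D)
    (hlip : LipschitzOnWith L f D) {E : Set κ} (hd : DualOn a d E) :
    ∃ K : ℝ, 0 ≤ K ∧ ∀ (v v' : H) (r r' : κ → ℝ) (x x' : H) (c c' : κ → ℝ) (δ : ℝ),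
      x ∈ D → x' ∈ D → IsKKT f a v r x c → IsKKT f a v' r' x' c' →
      (∀ k ∉ E, c k = 0) → (∀ k ∉ E, c' k = 0) →
      ‖v - v'‖ ≤ δ → (∀ k, |r k - r' k| ≤ δ) →
      ‖x - x'‖ ≤ K * δ ∧ ∑ k, |c k - c' k| ≤ K * δ := by
  set s : ℝ := ∑ k, ‖d k‖ with hs
  have hs0 : 0 ≤ s := by positivity
  -- Chosen for `μ t² ≤ δ t + s (δ + L t) δ` with `t = ‖x - x'‖`: if `t > K₀ δ`, then `δ ≤ t` bounds
  -- the right side by `(1 + s L + s) δ t`, too small. The summand `μ` ensures `K₀ ≥ 1`.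
  set K₀ : ℝ := (1 + s * L + s + μ) / μ with hK₀
  have hK₀0 : 0 ≤ K₀ := by positivity
  have hμK : μ * K₀ = 1 + s * L + s + μ := by rw [hK₀]; field_simp
  have hK1 : 1 ≤ K₀ := by
    rw [hK₀, one_le_div hμ]
    have : 0 ≤ s * L := by positivity
    linarith
  refine ⟨K₀ + s * (1 + L * K₀), by positivity, ?_⟩
  intro v v' r r' x x' c c' δ hx hx' h h' hc hc' hv hr
  have hδ : 0 ≤ δ := (norm_nonneg _).trans hv
  have hm := hmono x hx x' hx'
  have hl : ‖f x - f x'‖ ≤ L * ‖x - x'‖ := by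
    simpa [dist_eq_norm] using hlip.dist_le_mul x hx x' hx'
  have hsub : ∑ k, (c k - c' k) • a k = (v - v') - (f x - f x') := by
    simp only [sub_smul, Finset.sum_sub_distrib]
    rw [← h.stat, ← h'.stat]; abel
  have hmult : ∑ k, |c k - c' k| ≤ s * (δ + L * ‖x - x'‖) := by
    refine (hd.sum_abs_le fun k hk => by rw [hc k hk, hc' k hk, sub_zero]).trans ?_
    rw [hsub]
    gcongr
    exact (norm_sub_le _ _).trans (add_le_add hv hl)
  have k1 := inner_sum_smul_sub_le h.nonneg h.compl h'.mem
  have k2 := inner_sum_smul_sub_le h'.nonneg h'.compl h.mem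
  rw [← h.stat] at k1
  rw [← h'.stat] at k2
  have k3 : ∑ k, c k * (r' k - r k) + ∑ k, c' k * (r k - r' k) ≤ (∑ k, |c k - c' k|) * δ := by
    rw [← Finset.sum_add_distrib, Finset.sum_mul]
    refine Finset.sum_le_sum fun k _ => ?_
    calc c k * (r' k - r k) + c' k * (r k - r' k) = -((c k - c' k) * (r k - r' k)) := by ring
      _ ≤ |c k - c' k| * |r k - r' k| := by rw [← abs_mul]; exact neg_le_abs _
      _ ≤ |c k - c' k| * δ := by gcongr; exact hr k
  have k4 := real_inner_le_norm (v - v') (x - x')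
  have key : inner ℝ (f x - f x') (x - x') = inner ℝ (v - v') (x - x') +
      inner ℝ (v - f x) (x' - x) + inner ℝ (v' - f x') (x - x') := by
    simp only [inner_sub_left, inner_sub_right]
    ring
  have k5 : ‖v - v'‖ * ‖x - x'‖ ≤ δ * ‖x - x'‖ := by gcongr
  have k6 : (∑ k, |c k - c' k|) * δ ≤ s * (δ + L * ‖x - x'‖) * δ := by gcongr
  have hquad : μ * ‖x - x'‖ ^ 2 ≤ δ * ‖x - x'‖ + s * (δ + L * ‖x - x'‖) * δ := by linarith
  have hxx : ‖x - x'‖ ≤ K₀ * δ := by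
    by_contra! hlt
    set t := ‖x - x'‖
    have t0 : 0 ≤ t := norm_nonneg _
    have ht : δ ≤ t := (le_mul_of_one_le_left hδ hK1).trans hlt.le
    have tpos : 0 < t := (mul_nonneg hK₀0 hδ).trans_lt hlt
    have h1 : μ * (K₀ * δ) * t < μ * t * t := by gcongr
    have h2 : s * δ * δ ≤ s * δ * t := by gcongr
    have h3 : μ * (K₀ * δ) * t = (1 + s * L + s + μ) * δ * t := by rw [← hμK]; ring
    nlinarith [mul_nonneg (mul_nonneg hμ.le hδ) t0]
  have hsl : 0 ≤ s * (1 + L * K₀) * δ := by positivity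
  refine ⟨by linarith, hmult.trans ?_⟩
  have : s * (δ + L * ‖x - x'‖) ≤ s * (δ + L * (K₀ * δ)) := by gcongr
  nlinarith [mul_nonneg hK₀0 hδ]

/-- Near a KKT point with linearly independent active rows the variational inequalities are
solvable, and every solution has all its active constraints among those of the reference point. -/
theorem eventually_solvable [CompleteSpace H] (hμ : 0 < μ) (hmono : StronglyMonotoneOn μ f D)
    (hlip : LipschitzOnWith L f D) (hxD : x ∈ D)
    (hd : DualOn a d {k | inner ℝ (a k) x = r k}) (h : IsKKT f a v r x c) :
    ∀ᶠ q : H × (κ → ℝ) in 𝓝 (v, r), polyhedron a q.2 ⊆ D →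
      (∃ y, IsSolution f a q.1 q.2 y) ∧ ∀ y, IsSolution f a q.1 q.2 y →
        ∀ k, inner ℝ (a k) y = q.2 k → k ∈ {k | inner ℝ (a k) x = r k} := by
  obtain ⟨p, -, -, hfeas⟩ := hd.exists_feasible h.mem
  have e₁ : ∀ᶠ q : H × (κ → ℝ) in 𝓝 (v, r), p q.2 ∈ polyhedron a q.2 :=
    (continuous_snd.tendsto (v, r)).eventually hfeas
  have hinact : ∀ᶠ s : H × (H × (κ → ℝ)) in 𝓝 (x, (v, r)),
      ∀ k, inner ℝ (a k) s.1 = s.2.2 k → k ∈ {k | inner ℝ (a k) x = r k} := by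
    refine eventually_all.2 fun k => ?_
    by_cases hk : inner ℝ (a k) x = r k
    · exact Eventually.of_forall fun _ _ => hk
    · have c1 : Continuous fun s : H × (H × (κ → ℝ)) => inner ℝ (a k) s.1 := by fun_prop
      have c2 : Continuous fun s : H × (H × (κ → ℝ)) => s.2.2 k := by fun_prop
      exact (((c1.sub c2).tendsto (x, (v, r))).eventually_ne (sub_ne_zero.2 hk)).mono
        fun s hs hs' => absurd (sub_eq_zero.2 hs') hs
  rw [nhds_prod_eq] at hinact
  obtain ⟨P, hP, Q, hQ, hPQ⟩ := eventually_prod_iff.1 hinact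
  obtain ⟨ρ, hρ, hball⟩ := Metric.eventually_nhds_iff.1 hP
  have e₂ := eventually_norm_sub_le hμ hmono hlip hxD hd h (half_pos hρ)
  filter_upwards [e₁, e₂, hQ] with q h₁ h₂ h₃ hsub
  refine ⟨?_, fun y hy => hPQ (hball ?_) h₃⟩
  · obtain ⟨y, hy, hy'⟩ := exists_solution ⟨_, h₁⟩ (isClosed_polyhedron a q.2).isComplete
      (convex_polyhedron a q.2) (f := fun u => f u - q.1) hμ (L := L)
      (fun y hy z hz => by simpa using hmono y (hsub hy) z (hsub hz))
      (LipschitzOnWith.of_dist_le_mul fun y hy z hz => by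
        simpa using hlip.dist_le_mul y (hsub hy) z (hsub hz))
    exact ⟨y, hy, by simpa using hy'⟩
  · rw [dist_eq_norm]
    exact (h₂ hsub y hy).trans_lt (half_lt_self hρ)

end Perturbation

end PolyhedralVI

namespace ParamGame

open PolyhedralVI

variable {N : ℕ} {n p : Fin N → ℕ} {m ny nw : ℕ} (Γ : ParamGame N n p m ny nw)

/-- The rows of the stacked constraint matrix, as vectors. -/
def rowVec (k : Fin m ⊕ (Σ i, Fin (p i))) : EuclideanSpace ℝ (Σ i, Fin (n i)) :=
  WithLp.toLp 2 (Γ.stackedMatrix.row k)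

/-- The stacked right-hand side with the coupling constraints tightened by `e`. -/
def tightenedRhs (e : EuclideanSpace ℝ (Fin m)) : Fin m ⊕ (Σ i, Fin (p i)) → ℝ :=
  Sum.elim (fun k => Γ.b k - e k) (fun k => Γ.bloc k.1 k.2)

theorem continuous_tightenedRhs : Continuous Γ.tightenedRhs := by
  refine continuous_pi fun k => ?_
  rcases k with k | k
  · simp only [tightenedRhs, Sum.elim_inl]; fun_prop
  · simp only [tightenedRhs, Sum.elim_inr]; fun_prop

theorem tightenedRhs_zero : Γ.tightenedRhs 0 = Γ.stackedRhs := by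
  ext k
  rcases k with k | k <;> simp [tightenedRhs, stackedRhs]

theorem inner_rowVec (k : Fin m ⊕ (Σ i, Fin (p i))) (x : EuclideanSpace ℝ (Σ i, Fin (n i))) :
    inner ℝ (Γ.rowVec k) x = (Γ.stackedMatrix *ᵥ x.ofLp) k := by
  simp [rowVec, PiLp.inner_apply, Matrix.mulVec, dotProduct, mul_comm]

theorem inner_rowVec_inl (k : Fin m) (x : EuclideanSpace ℝ (Σ i, Fin (n i))) :
    inner ℝ (Γ.rowVec (Sum.inl k)) x = (Γ.A *ᵥ x.ofLp) k := by
  rw [inner_rowVec, stackedMatrix, Matrix.fromRows_mulVec, Sum.elim_inl]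

theorem inner_rowVec_inr (k : Σ i, Fin (p i)) (x : EuclideanSpace ℝ (Σ i, Fin (n i))) :
    inner ℝ (Γ.rowVec (Sum.inr k)) x = (Γ.B k.1 *ᵥ (block x k.1).ofLp) k.2 := by
  obtain ⟨i, r⟩ := k
  rw [inner_rowVec, stackedMatrix, Matrix.fromRows_mulVec, Sum.elim_inr]
  simp only [Matrix.mulVec, dotProduct, block, Fintype.sum_sigma]
  rw [Finset.sum_eq_single i]
  · simp [Matrix.blockDiagonal'_apply_eq]
  · intro j _ hj
    exact Finset.sum_eq_zero fun l _ => by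
      rw [Matrix.blockDiagonal'_apply_ne _ _ _ hj.symm, zero_mul]
  · simp

theorem actionSet_eq_polyhedron :
    Γ.actionSet = polyhedron (fun k => Γ.rowVec (Sum.inr k)) (fun k => Γ.bloc k.1 k.2) := by
  ext u
  simp only [actionSet, localSet, polyhedron, Set.mem_ofPred_eq, inner_rowVec_inr, Sigma.forall]

theorem mem_polyhedron_tightenedRhs {e : EuclideanSpace ℝ (Fin m)}
    {u : EuclideanSpace ℝ (Σ i, Fin (n i))} :
    u ∈ polyhedron Γ.rowVec (Γ.tightenedRhs e) ↔
      (∀ k, inner ℝ (Γ.rowVec (Sum.inl k)) u ≤ Γ.b k - e k) ∧ u ∈ Γ.actionSet := by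
  rw [actionSet_eq_polyhedron]
  simp [polyhedron, Sum.forall, tightenedRhs]

theorem polyhedron_subset_actionSet (e : EuclideanSpace ℝ (Fin m)) :
    polyhedron Γ.rowVec (Γ.tightenedRhs e) ⊆ Γ.actionSet :=
  fun _ hu => (Γ.mem_polyhedron_tightenedRhs.1 hu).2

theorem LICQ.exists_dualOn {u : EuclideanSpace ℝ (Σ i, Fin (n i))} (h : Γ.LICQ u) :
    ∃ d, DualOn Γ.rowVec d {k | inner ℝ (Γ.rowVec k) u = Γ.tightenedRhs 0 k} := by
  refine PolyhedralVI.exists_dualOn ?_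
  have hset : {k | inner ℝ (Γ.rowVec k) u = Γ.tightenedRhs 0 k} = Γ.activeSet u := by
    ext k
    rw [Set.mem_ofPred_eq, inner_rowVec, tightenedRhs_zero]
    rfl
  rw [hset]
  exact h.map' (WithLp.linearEquiv 2 ℝ _).symm.toLinearMap (LinearEquiv.ker _)

theorem transpose_mulVec_eq_sum (l : EuclideanSpace ℝ (Fin m)) :
    WithLp.toLp 2 (Γ.Aᵀ *ᵥ l.ofLp) = ∑ k, l k • Γ.rowVec (Sum.inl k) := by
  ext j
  simp [rowVec, stackedMatrix, Matrix.mulVec, dotProduct, mul_comm]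

theorem mem_normalConeAt_orthant {l η : EuclideanSpace ℝ (Fin m)} :
    η ∈ normalConeAt (orthant m) l ↔
      (∀ k, 0 ≤ l k) ∧ (∀ k, η k ≤ 0) ∧ ∀ k, l k * η k = 0 := by
  constructor
  · rintro ⟨hl, h⟩
    have hη : ∀ k, η k ≤ 0 := fun k => by
      have := h (l + EuclideanSpace.single k 1) fun j => by
        have := hl j
        by_cases hj : j = k <;> simp [hj] <;> first | exact this | (subst hj; linarith)
      simpa [EuclideanSpace.inner_single_right] using this
    refine ⟨hl, hη, fun k => ?_⟩
    have h1 := h (l - EuclideanSpace.single k (l k)) fun j => by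
      have := hl j
      by_cases hj : j = k
      · subst hj; simp
      · simpa [hj] using this
    have h2 : 0 ≤ l k * η k := by
      simpa [EuclideanSpace.inner_single_right, inner_neg_right] using h1
    exact le_antisymm (mul_nonpos_of_nonneg_of_nonpos (hl k) (hη k)) h2
  · rintro ⟨hl, hη, h0⟩
    refine ⟨hl, fun y hy => ?_⟩
    rw [inner_sub_right]
    simp only [PiLp.inner_apply, RCLike.inner_apply, conj_trivial]
    rw [Finset.sum_eq_zero fun k (_ : k ∈ Finset.univ) => h0 k, sub_zero]
    exact Finset.sum_nonpos fun k _ => mul_nonpos_of_nonneg_of_nonpos (hy k) (hη k)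

variable (F : EuclideanSpace ℝ (Σ i, Fin (n i)) → EuclideanSpace ℝ (Fin ny) →
  EuclideanSpace ℝ (Σ i, Fin (n i)))

/-- The inverse of the condensed mapping, in terms of the constraint rows. -/
theorem mem_condensedMap_iff (w : EuclideanSpace ℝ (Fin nw)) (z v : ZSpace n m) :
    v ∈ Γ.condensedMap F w z ↔
      z.fst ∈ polyhedron Γ.rowVec (Γ.tightenedRhs v.snd) ∧ (∀ k, 0 ≤ z.snd k) ∧
      (∀ k, z.snd k * (Γ.b k - v.snd k - inner ℝ (Γ.rowVec (Sum.inl k)) z.fst) = 0) ∧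
      ∀ y ∈ Γ.actionSet, inner ℝ
        (v.fst - F z.fst (Γ.h z.fst w) - ∑ k, z.snd k • Γ.rowVec (Sum.inl k)) (y - z.fst) ≤ 0 := by
  rw [mem_polyhedron_tightenedRhs]
  constructor
  · rintro ⟨_, ⟨ν, ⟨hu, hν⟩, η, hη, rfl⟩, rfl⟩
    obtain ⟨h1, h2, h3⟩ := mem_normalConeAt_orthant.1 hη
    have e : ∀ k, Γ.b k - (Γ.b k + (-(Γ.A *ᵥ z.fst.ofLp) k + η k)) -
        inner ℝ (Γ.rowVec (Sum.inl k)) z.fst = -η k := fun k => by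
      rw [inner_rowVec_inl]; ring
    refine ⟨⟨fun k => ?_, hu⟩, h1, fun k => ?_, fun y hy => ?_⟩
    · change _ ≤ Γ.b k - (Γ.b k + (-(Γ.A *ᵥ z.fst.ofLp) k + η k))
      linarith [e k, h2 k]
    · change _ * (Γ.b k - (Γ.b k + (-(Γ.A *ᵥ z.fst.ofLp) k + η k)) - _) = 0
      rw [e k, mul_neg, h3 k, neg_zero]
    · convert hν y hy using 2
      rw [transpose_mulVec_eq_sum]
      change F z.fst (Γ.h z.fst w) + (_ + ν) - F z.fst (Γ.h z.fst w) - _ = ν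
      abel
  · rintro ⟨⟨h0, hu⟩, h1, h2, h3⟩
    refine ⟨v - Γ.mapG F z (Γ.h z.fst w), ⟨_, ⟨hu, h3⟩,
      v.snd - WithLp.toLp 2 Γ.b + WithLp.toLp 2 (Γ.A *ᵥ z.fst.ofLp), ?_, ?_⟩, by abel⟩
    · have e : ∀ k, (v.snd - WithLp.toLp 2 Γ.b + WithLp.toLp 2 (Γ.A *ᵥ z.fst.ofLp)) k =
          -(Γ.b k - v.snd k - inner ℝ (Γ.rowVec (Sum.inl k)) z.fst) := fun k => by
        rw [inner_rowVec_inl]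
        simp only [PiLp.add_apply, PiLp.sub_apply]
        ring
      refine mem_normalConeAt_orthant.2 ⟨h1, fun k => ?_, fun k => ?_⟩
      · rw [e]; linarith [h0 k]
      · rw [e, mul_neg, h2 k, neg_zero]
    · rw [transpose_mulVec_eq_sum]
      refine (WithLp.equiv 2 _).injective (Prod.ext ?_ ?_)
      · change v.fst - F z.fst (Γ.h z.fst w) = _ + (_ - _)
        abel
      · change v.snd - WithLp.toLp 2 Γ.b = -_ + (_ - _ + _)
        abel

variable {Γ F}

theorem mem_condensedMap_of_isKKT {w : EuclideanSpace ℝ (Fin nw)} {v : ZSpace n m}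
    {u : EuclideanSpace ℝ (Σ i, Fin (n i))} {c : Fin m ⊕ (Σ i, Fin (p i)) → ℝ}
    (h : IsKKT (fun u => F u (Γ.h u w)) Γ.rowVec v.fst (Γ.tightenedRhs v.snd) u c) :
    v ∈ Γ.condensedMap F w
      (WithLp.toLp 2 (u, WithLp.toLp 2 fun k => c (Sum.inl k)) : ZSpace n m) := by
  rw [mem_condensedMap_iff]
  refine ⟨h.mem, fun k => h.nonneg _, fun k => h.compl (Sum.inl k), fun y hy => ?_⟩
  have h1 := h.stat
  rw [Fintype.sum_sum_type] at h1
  change inner ℝ (v.fst - F u (Γ.h u w) - ∑ k, c (Sum.inl k) • Γ.rowVec (Sum.inl k)) (y - u) ≤ 0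
  rw [h1, add_sub_cancel_left]
  rw [actionSet_eq_polyhedron] at hy
  exact (inner_sum_smul_sub_le (fun k => h.nonneg (Sum.inr k)) (fun k => h.compl (Sum.inr k))
    hy).trans (by simp [tightenedRhs])

theorem isSolution_of_mem_condensedMap {w : EuclideanSpace ℝ (Fin nw)} {v z : ZSpace n m}
    (h : v ∈ Γ.condensedMap F w z) :
    IsSolution (fun u => F u (Γ.h u w)) Γ.rowVec v.fst (Γ.tightenedRhs v.snd) z.fst := by
  obtain ⟨h0, h1, h2, h3⟩ := (Γ.mem_condensedMap_iff F w z v).1 h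
  refine ⟨h0, fun y hy => ?_⟩
  have hy' := Γ.mem_polyhedron_tightenedRhs.1 hy
  have h4 := h3 y hy'.2
  have h5 := (inner_sum_smul_sub_le h1 h2 hy'.1).trans (by simp : _ ≤ (0 : ℝ))
  rw [inner_sub_left] at h4
  linarith

theorem exists_isKKT_of_mem_condensedMap {w : EuclideanSpace ℝ (Fin nw)} {v z : ZSpace n m}
    (h : v ∈ Γ.condensedMap F w z) {d : Fin m ⊕ (Σ i, Fin (p i)) → EuclideanSpace ℝ (Σ i, Fin (n i))}
    {E : Set (Fin m ⊕ (Σ i, Fin (p i)))} (hd : DualOn Γ.rowVec d E)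
    (hE : ∀ k, inner ℝ (Γ.rowVec k) z.fst = Γ.tightenedRhs v.snd k → k ∈ E) :
    ∃ c, IsKKT (fun u => F u (Γ.h u w)) Γ.rowVec v.fst (Γ.tightenedRhs v.snd) z.fst c ∧
      ∀ k, c (Sum.inl k) = z.snd k := by
  obtain ⟨h0, h1, h2, h3⟩ := (Γ.mem_condensedMap_iff F w z v).1 h
  have hd' : DualOn (fun k => Γ.rowVec (Sum.inr k)) (fun k => d (Sum.inr k)) {k | Sum.inr k ∈ E} :=
    ⟨fun j hj => hd.one _ hj, fun j hj k hk hjk =>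
      hd.zero _ hj _ hk fun he => hjk (Sum.inr_injective he)⟩
  have hu := (Γ.mem_polyhedron_tightenedRhs.1 h0).2
  rw [actionSet_eq_polyhedron] at h3 hu
  obtain ⟨c, c1, c2, c3⟩ := hd'.exists_multipliers hu (fun k hk => hE _ hk) h3
  refine ⟨Sum.elim z.snd.ofLp c, ⟨h0, ?_, ?_, ?_⟩, fun k => rfl⟩
  · exact fun k => Sum.rec h1 c1 k
  · exact fun k => Sum.rec h2 c2 k
  · rw [Fintype.sum_sum_type]
    simp only [Sum.elim_inl, Sum.elim_inr]
    rw [← c3]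
    abel

theorem dist_le_of_block_le {z z' : ZSpace n m} {c c' : Fin m ⊕ (Σ i, Fin (p i)) → ℝ}
    (hc : ∀ k, c (Sum.inl k) = z.snd k) (hc' : ∀ k, c' (Sum.inl k) = z'.snd k) {M : ℝ}
    (h₁ : ‖z.fst - z'.fst‖ ≤ M) (h₂ : ∑ k, |c k - c' k| ≤ M) : dist z z' ≤ 2 * M := by
  have hsnd : ‖z.snd - z'.snd‖ ≤ ∑ k, |c k - c' k| := by
    rw [Fintype.sum_sum_type]
    have e : z.snd - z'.snd =
        ∑ k, EuclideanSpace.single k (c (Sum.inl k) - c' (Sum.inl k)) := by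
      ext j
      simp [hc, hc', Finset.sum_apply, Pi.single_apply]
    rw [e]
    refine (norm_sum_le _ _).trans ?_
    simp only [PiLp.norm_single, Real.norm_eq_abs]
    exact le_add_of_nonneg_right (Finset.sum_nonneg fun _ _ => abs_nonneg _)
  have h0 : 0 ≤ M := (norm_nonneg _).trans h₁
  rw [dist_eq_norm, WithLp.prod_norm_eq_of_L2]
  refine Real.sqrt_le_iff.2 ⟨by positivity, ?_⟩
  have a1 : ‖(z - z').fst‖ ^ 2 ≤ M ^ 2 := by
    gcongr; exact h₁
  have a2 : ‖(z - z').snd‖ ^ 2 ≤ M ^ 2 := by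
    gcongr; exact hsnd.trans h₂
  nlinarith [sq_nonneg M]

end ParamGame

open ParamGame PolyhedralVI in
theorem mainTheorem9 {N : ℕ} {n p : Fin N → ℕ} {m ny nw : ℕ}
    (Γ : ParamGame N n p m ny nw)
    (F : EuclideanSpace ℝ (Σ i, Fin (n i)) → EuclideanSpace ℝ (Fin ny) →
      EuclideanSpace ℝ (Σ i, Fin (n i)))
    (hF : Γ.IsPseudoGradient F)
    (μ : ℝ) (hμ : 0 < μ) (ℓ' ℓ : ℝ≥0)
    -- the pseudo-gradient `(u, w) ↦ F(u, h(u, w))` is continuously differentiable, and strongly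
    -- monotone and Lipschitz in `u`, uniformly in `w`
    (hC1_diff : ContDiffOn ℝ 1
      (fun q : EuclideanSpace ℝ (Σ i, Fin (n i)) × EuclideanSpace ℝ (Fin nw) =>
        F q.1 (Γ.h q.1 q.2)) (Γ.actionSet ×ˢ Γ.W))
    (hC1_mono : ∀ w ∈ Γ.W, StronglyMonotoneOn μ (fun u => F u (Γ.h u w)) Γ.actionSet)
    (hC1_lip : ∀ w ∈ Γ.W, LipschitzOnWith ℓ' (fun u => F u (Γ.h u w)) Γ.actionSet)
    -- `F` is Lipschitz in `s`
    (hC2 : ∀ u ∈ Γ.actionSet, LipschitzWith ℓ (F u))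
    -- LICQ at every solution
    (hC3 : ∀ w ∈ Γ.W, ∀ z ∈ Γ.solutionSet F w, Γ.LICQ z.fst) :
    ∀ w ∈ Γ.W, ∀ z ∈ Γ.solutionSet F w, StronglyRegularAt (Γ.condensedMap F w) z 0 := by
  intro w hw z hz
  have hz0 : (0 : ZSpace n m) ∈ Γ.condensedMap F w z := hz
  refine ⟨hz0, ?_⟩
  have hmono := hC1_mono w hw
  have hlip := hC1_lip w hw
  obtain ⟨d, hd⟩ := (hC3 w hw z hz).exists_dualOn
  set E := {k | inner ℝ (Γ.rowVec k) z.fst = Γ.tightenedRhs 0 k} with hE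
  obtain ⟨c, hc, -⟩ := exists_isKKT_of_mem_condensedMap hz0 hd fun k hk => hk
  have hzD : z.fst ∈ Γ.actionSet := Γ.polyhedron_subset_actionSet _ hc.mem
  have hsolv := eventually_solvable hμ hmono hlip hzD hd hc
  obtain ⟨K, hK, hest⟩ := IsKKT.lipschitz_estimate hμ hmono hlip hd
  have hcont : Continuous fun v : ZSpace n m => (v.fst, Γ.tightenedRhs v.snd) :=
    (WithLp.continuous_fst 2 _ _).prodMk
      (Γ.continuous_tightenedRhs.comp (WithLp.continuous_snd 2 _ _))
  have hV := (hcont.tendsto 0).eventually hsolv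
  obtain ⟨V, hV, hVV⟩ := hV.exists_mem
  have hlipz : ∀ v ∈ V, ∀ v' ∈ V, ∀ x x' : ZSpace n m, v ∈ Γ.condensedMap F w x →
      v' ∈ Γ.condensedMap F w x' → dist x x' ≤ 2 * K * dist v v' := by
    intro v hv v' hv' x x' hx hx'
    have hact := (hVV v hv (Γ.polyhedron_subset_actionSet _)).2 _ (isSolution_of_mem_condensedMap hx)
    have hact' :=
      (hVV v' hv' (Γ.polyhedron_subset_actionSet _)).2 _ (isSolution_of_mem_condensedMap hx')
    obtain ⟨c, hc, hcx⟩ := exists_isKKT_of_mem_condensedMap hx hd hact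
    obtain ⟨c', hc', hcx'⟩ := exists_isKKT_of_mem_condensedMap hx' hd hact'
    have hfst : ‖v.fst - v'.fst‖ ≤ dist v v' := by
      rw [dist_eq_norm]
      exact WithLp.norm_fst_le _ (v - v')
    have hsnd : ∀ k, |Γ.tightenedRhs v.snd k - Γ.tightenedRhs v'.snd k| ≤ dist v v' := by
      rintro (k | k)
      · have e : |Γ.tightenedRhs v.snd (Sum.inl k) - Γ.tightenedRhs v'.snd (Sum.inl k)| =
            ‖(v.snd - v'.snd) k‖ := by
          rw [Real.norm_eq_abs, ← abs_neg]
          simp [tightenedRhs]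
        rw [e, dist_eq_norm]
        exact (PiLp.norm_apply_le _ _).trans (WithLp.norm_snd_le _ (v - v'))
      · simp [tightenedRhs]
    obtain ⟨e₁, e₂⟩ := hest _ _ _ _ _ _ c c' _ (Γ.polyhedron_subset_actionSet _ hc.mem)
      (Γ.polyhedron_subset_actionSet _ hc'.mem) hc hc' (hc.eq_zero hact) (hc'.eq_zero hact')
      hfst hsnd
    rw [mul_assoc]
    exact dist_le_of_block_le hcx hcx' e₁ e₂
  have hex : ∀ v : ZSpace n m, ∃ x, v ∈ V → v ∈ Γ.condensedMap F w x := by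
    intro v
    by_cases hv : v ∈ V
    · obtain ⟨⟨u, hu⟩, hact⟩ := hVV v hv (Γ.polyhedron_subset_actionSet _)
      obtain ⟨c, hc⟩ := hu.exists_isKKT hd (hact u hu)
      exact ⟨_, fun _ => mem_condensedMap_of_isKKT hc⟩
    · exact ⟨0, fun h => absurd h hv⟩
  choose g hg using hex
  refine ⟨Set.univ, Filter.univ_mem, V, hV, (2 * K).toNNReal, g,
    LipschitzOnWith.of_dist_le_mul fun v hv v' hv' => ?_, fun v hv => ?_⟩
  · rw [Real.coe_toNNReal _ (by positivity)]
    exact hlipz v hv v' hv' _ _ (hg v hv) (hg v' hv')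
  · refine Set.eq_singleton_iff_unique_mem.2 ⟨⟨hg v hv, trivial⟩, fun x hx => ?_⟩
    have := hlipz v hv v hv x (g v) hx.1 (hg v hv)
    rw [dist_self, mul_zero] at this
    exact dist_le_zero.1 this
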